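/- Let $k$ be a field of characteristic zero and let $B=\bigoplus_{i\ge 0}B_i$ be a standard graded artinian $k$-algebra, that is, a nonzero artinian quotient of a polynomial ring $k[x_1,\dots,x_n]$ (all variables of degree one) by a homogeneous ideal. A graded $k$-algebra $A=\bigoplus_{i\ge0} A_i$ is said to have the strong Lefschetz property (SLP) if there is a linear form $\ell\in A_1$ such that, for all integers $i,t\ge 0$, the multiplication map $\cdot\ell^t\colon A_i\to A_{i+t}$ has full rank, i.e. is injective or surjective. Put $h_i=\dim_k B_i$ for $i\ge 0$ and $h_i=0$ for $i<0$. We say that $B$ is almost centered if, for all integers $i<j$, - if $h_i<h_j$, then $h_{i-s}\le h_{j+s}$ for all integers $s\ge 0$; and - if $h_i>h_j$, then $h_{i-s}\ge h_{j+s}$ for all integers $s\ge 0$. For $d\ge1$ let $B\otimes_k k[x]/(x^d)$ carry the tensor product grading, with $x$ of degree one. **Theorem.** The algebra $B\otimes_k k[x]/(x^d)$ has the SLP for every integer $d\ge 1$ if and only if $B$ is almost centered and has the SLP. -/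

import Mathlib

open scoped TensorProduct Polynomial

section Lefschetz

variable {k : Type*} [Field k]

/-- A standard graded algebra over the field `k`: an `ℕ`-graded commutative algebra
`B = B₀ ⊕ B₁ ⊕ ⋯` with `B₀ = k`, generated as a `k`-algebra by `B₁`, which is finite dimensional.
Equivalently, the quotient of a polynomial ring `k[x₁, …, xₙ]`, with all variables of degree one,
by a proper homogeneous ideal. -/
structure IsStandardGraded {B : Type*} [CommRing B] [Algebra k B]
    (𝒜 : ℕ → Submodule k B) [GradedAlgebra 𝒜] : Prop where
  nontrivial : Nontrivial B
  degree_zero : 𝒜 0 = Submodule.span k {(1 : B)}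
  generated : Algebra.adjoin k (𝒜 1 : Set B) = ⊤
  finite_degree_one : Module.Finite k (𝒜 1)

/-- Multiplication by `f`, as a map from `V` to `W` has full rank, i.e. it is injective or
surjective. It is used for `V`, `W` graded pieces with `f * V ⊆ W`. -/
def MulHasFullRank {A : Type*} [CommRing A] [Algebra k A] (f : A) (V W : Submodule k A) : Prop :=
  Set.InjOn (fun a : A => f * a) (V : Set A) ∨
    Set.SurjOn (fun a : A => f * a) (V : Set A) (W : Set A)

/-- The strong Lefschetz property of an algebra with graded pieces `𝒜 0, 𝒜 1, …`: there is a linear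
form `ℓ` such that all maps `ℓ ^ t : 𝒜 i → 𝒜 (i + t)` have full rank. -/
def HasSLP {A : Type*} [CommRing A] [Algebra k A] (𝒜 : ℕ → Submodule k A) : Prop :=
  ∃ ℓ ∈ 𝒜 1, ∀ t i : ℕ, MulHasFullRank (ℓ ^ t) (𝒜 i) (𝒜 (i + t))

/-- The Hilbert function `i ↦ dim_k 𝒜 i`, extended by zero to negative degrees. -/
noncomputable def hilbertFn {A : Type*} [CommRing A] [Algebra k A] (𝒜 : ℕ → Submodule k A) :
    ℤ → ℕ
  | Int.ofNat i => Module.finrank k (𝒜 i)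
  | Int.negSucc _ => 0

/-- The almost centered condition on the Hilbert function. -/
def IsAlmostCentered {A : Type*} [CommRing A] [Algebra k A] (𝒜 : ℕ → Submodule k A) : Prop :=
  ∀ i j : ℤ, i < j →
    (hilbertFn 𝒜 i < hilbertFn 𝒜 j → ∀ s : ℕ, hilbertFn 𝒜 (i - s) ≤ hilbertFn 𝒜 (j + s)) ∧
    (hilbertFn 𝒜 i > hilbertFn 𝒜 j → ∀ s : ℕ, hilbertFn 𝒜 (i - s) ≥ hilbertFn 𝒜 (j + s))

variable (k) in
/-- The algebra `k[x]/(x^d)`. -/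
abbrev TruncPoly (d : ℕ) : Type _ := k[X] ⧸ Ideal.span {(Polynomial.X : k[X]) ^ d}

variable (k) in
/-- The degree `j` part of `k[x]/(x^d)`, spanned by the class of `x^j`. -/
noncomputable def truncPolyGrading (d j : ℕ) : Submodule k (TruncPoly k d) :=
  Submodule.span k {Ideal.Quotient.mk (Ideal.span {(Polynomial.X : k[X]) ^ d}) (Polynomial.X ^ j)}

/-- The tensor product grading `(B ⊗ C)_n = ⊕_{i + j = n} B_i ⊗ C_j`; the image of `B_i ⊗ C_j` in
`B ⊗ C` is the span of the tensors `b ⊗ c` with `b ∈ B_i` and `c ∈ C_j`. -/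
def tensorGrading {B C : Type*} [CommRing B] [Algebra k B] [CommRing C] [Algebra k C]
    (𝒜 : ℕ → Submodule k B) (𝒞 : ℕ → Submodule k C) (n : ℕ) : Submodule k (B ⊗[k] C) :=
  ⨆ (i : ℕ) (j : ℕ) (_ : i + j = n), Submodule.map₂ (TensorProduct.mk k B C) (𝒜 i) (𝒞 j)

end Lefschetz

/-! For a linear form ℓ, B splits as a graded k[ℓ]-module into strings v, ℓv, …, ℓ^(m-1)v starting
in degree a (`exists_isStringBasis`), and h_i counts the strings meeting degree i. Both sides of the
equivalence amount to one condition (C): for a suitable ℓ, the values 2a + m of any two strings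
differ by at most 1, i.e. their centers are at most 1/2 apart.

(C) suffices: a string tensored with k[x]/(x^d) is an sl₂-module raised by ℓ + x, so (ℓ + x)^t from
degree i is injective if 2i + t + 2 ≤ 2a + m + d and surjective if ≥ holds. Under (C) all strings
fall on the same side (`injOn_or_surjOn`); d = 1 is the SLP of B itself. Almost centeredness is then
a count (`card_stringsAt_of_center_le`).

(C) is necessary: a full rank power of a linear form makes the dimensions of all strands weakly
increase together or weakly decrease together. For d at least all string lengths this forces (C)
(`center_le_of_strandCount`). If only B has the SLP, the sets of strings meeting two degrees are
nested, and almost centeredness supplies the rest (`center_le_of_card_stringsAt`). -/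

open scoped TensorProduct Polynomial

/-! ### Graded sl₂ actions: injectivity and surjectivity of powers -/

section SlTwo

variable {k V : Type*} [Field k] [AddCommGroup V] [Module k V]

/-- Operators `E` and `F`, of degrees `1` and `-1` for the grading `W`, whose commutator acts on
`W i` as the scalar `2 * i + 2 - μ`. -/
structure IsGradedSlTwo (W : ℕ → Submodule k V) (E F : Module.End k V) (μ : ℕ) : Prop where
  raise : ∀ i, ∀ v ∈ W i, E v ∈ W (i + 1)
  lower : ∀ i, ∀ v ∈ W (i + 1), F v ∈ W i
  lower_zero : ∀ v ∈ W 0, F v = 0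
  comm : ∀ i, ∀ v ∈ W i, E (F v) = F (E v) + ((2 * i + 2 : k) - μ) • v

theorem pow_raise_mem {W : ℕ → Submodule k V} {E : Module.End k V}
    (hE : ∀ i, ∀ v ∈ W i, E v ∈ W (i + 1)) (t i : ℕ) {v : V} (hv : v ∈ W i) :
    (E ^ t) v ∈ W (i + t) := by
  induction t with
  | zero => simpa using hv
  | succ t ih =>
    rw [pow_succ', Module.End.mul_apply]
    exact hE _ _ ih

theorem pow_lower_mem {W : ℕ → Submodule k V} {F : Module.End k V}
    (hF : ∀ i, ∀ v ∈ W (i + 1), F v ∈ W i) (t i : ℕ) {v : V} (hv : v ∈ W (i + t)) :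
    (F ^ t) v ∈ W i := by
  induction t generalizing i with
  | zero => simpa using hv
  | succ t ih =>
    rw [pow_succ', Module.End.mul_apply]
    exact hF _ _ (ih (i + 1) (by rwa [add_right_comm, add_assoc]))

namespace IsGradedSlTwo

variable {W : ℕ → Submodule k V} {E F : Module.End k V} {μ : ℕ}

/-- The commutator scalars 2(i + j) + 2 - μ, for j = 0, …, t, sum to the coefficient. -/
theorem pow_raise_lower (h : IsGradedSlTwo W E F μ) (t i : ℕ) {v : V} (hv : v ∈ W i) :
    (E ^ (t + 1)) (F v) =
      F ((E ^ (t + 1)) v) + ((t + 1 : k) * (2 * i + 2 - μ + t)) • (E ^ t) v := by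
  induction t with
  | zero => simpa using h.comm i v hv
  | succ t ih =>
    rw [pow_succ' E (t + 1), Module.End.mul_apply, ih, map_add, map_smul,
      h.comm _ _ (pow_raise_mem h.raise (t + 1) i hv), Module.End.mul_apply,
      ← Module.End.mul_apply E (E ^ t), ← pow_succ', add_assoc, ← add_smul]
    congr 2
    push_cast
    ring

/-- On a lowest weight vector the commutation formula turns E^(t+1) v = 0 into a nonzero multiple of
E^t v being 0, so t descends to 0. -/
theorem eq_zero_of_lower_eq_zero [CharZero k] (h : IsGradedSlTwo W E F μ) {t i : ℕ} (hμ : 2 * i + t + 2 ≤ μ)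
    {v : V} (hv : v ∈ W i) (hFv : F v = 0) (ht : (E ^ t) v = 0) : v = 0 := by
  induction t with
  | zero => simpa using ht
  | succ t ih =>
    refine ih (by omega) ?_
    have key := h.pow_raise_lower t i hv
    rw [hFv, ht, map_zero, map_zero, zero_add] at key
    refine (smul_eq_zero.1 key.symm).resolve_left (mul_ne_zero (by exact_mod_cast t.succ_ne_zero) ?_)
    intro h0
    have : ((2 * i + 2 + t : ℕ) : k) = μ := by push_cast; linear_combination h0
    have := Nat.cast_injective this
    omega

/-- F v lies one degree lower and is killed by E^(t+1), so it vanishes by induction on the degree;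
then v is a lowest weight vector. -/
theorem pow_raise_eq_zero [CharZero k] (h : IsGradedSlTwo W E F μ) {t i : ℕ} (hμ : 2 * i + t + 2 ≤ μ)
    {v : V} (hv : v ∈ W i) (ht : (E ^ t) v = 0) : v = 0 := by
  induction i generalizing t v with
  | zero => exact h.eq_zero_of_lower_eq_zero hμ hv (h.lower_zero v hv) ht
  | succ i ih =>
    refine h.eq_zero_of_lower_eq_zero hμ hv (ih (t := t + 1) (by omega) (h.lower i v hv) ?_) ht
    rw [h.pow_raise_lower t _ hv, pow_succ', Module.End.mul_apply, ht]
    simp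

theorem raise_pow_lower (h : IsGradedSlTwo W E F μ) (t i : ℕ) {w : V} (hw : w ∈ W (i + t))
    (hEw : E w = 0) :
    E ((F ^ (t + 1)) w) = ((t + 1 : k) * (2 * (i + t) + 2 - μ - t)) • (F ^ t) w := by
  induction t generalizing i with
  | zero => simpa [hEw] using h.comm _ w hw
  | succ t ih =>
    rw [pow_succ' F (t + 1), Module.End.mul_apply, h.comm i _ (pow_lower_mem h.lower _ _ hw),
      ih (i + 1) (by rwa [add_right_comm, add_assoc]), map_smul, ← Module.End.mul_apply F (F ^ t),
      ← pow_succ', ← add_smul]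
    congr 1
    push_cast
    ring

theorem exists_pow_raise_pow_lower [CharZero k] (h : IsGradedSlTwo W E F μ) {t i : ℕ} {w : V} {n : ℕ}
    (hn : n = i + t) (hw : w ∈ W n) (hEw : E w = 0) (hμ : μ + t ≤ 2 * n + 2) :
    ∃ c : k, c ≠ 0 ∧ (E ^ t) ((F ^ t) w) = c • w := by
  induction t generalizing i with
  | zero => exact ⟨1, one_ne_zero, by simp⟩
  | succ t ih =>
    obtain ⟨c, hc, hcw⟩ := ih (i := i + 1) (by omega) (by omega)
    have hw' : w ∈ W (i + 1 + t) := by rwa [show i + 1 + t = n by omega]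
    refine ⟨((t + 1 : k) * (2 * ((i + 1 : ℕ) + t) + 2 - μ - t)) * c,
      mul_ne_zero (mul_ne_zero (by exact_mod_cast t.succ_ne_zero) ?_) hc, ?_⟩
    · intro h0
      have : ((2 * (i + 1 + t) + 2 : ℕ) : k) = (μ + t : ℕ) := by
        push_cast at h0 ⊢; linear_combination h0
      have := Nat.cast_injective this
      omega
    · rw [pow_succ E, Module.End.mul_apply, h.raise_pow_lower t _ hw' hEw, map_smul, hcw, smul_smul]

/-- Descending induction on the target degree: E w = E^(t+1) u for some u, so w - E^t u is a highest
weight vector, on which E^t F^t is a nonzero scalar. -/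
theorem exists_pow_raise_eq [CharZero k] (h : IsGradedSlTwo W E F μ) {D : ℕ} (hD : ∀ n, D ≤ n → W n = ⊥)
    {t i : ℕ} (hμ : μ ≤ 2 * i + t + 2) {w : V} (hw : w ∈ W (i + t)) :
    ∃ u ∈ W i, (E ^ t) u = w := by
  obtain ⟨n, hn⟩ : ∃ n, D ≤ i + t + n := ⟨D, by omega⟩
  induction n generalizing t w with
  | zero =>
    rw [hD _ (by omega), Submodule.mem_bot] at hw
    exact ⟨0, zero_mem _, by simp [hw]⟩
  | succ n ih =>
    obtain ⟨u, hu, hEu⟩ := ih (t := t + 1) (by omega) (h.raise _ _ hw) (by omega)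
    have hmem : w - (E ^ t) u ∈ W (i + t) := sub_mem hw (pow_raise_mem h.raise t i hu)
    obtain ⟨c, hc, hcw⟩ := h.exists_pow_raise_pow_lower (t := t) rfl hmem
      (by rw [map_sub, ← Module.End.mul_apply E, ← pow_succ', hEu, sub_self]) (by omega)
    refine ⟨u + c⁻¹ • (F ^ t) (w - (E ^ t) u),
      add_mem hu (Submodule.smul_mem _ _ (pow_lower_mem h.lower t i hmem)), ?_⟩
    rw [map_add, map_smul, hcw, smul_smul, inv_mul_cancel₀ hc, one_smul]
    abel

end IsGradedSlTwo

end SlTwo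

/-! ### String bases and full rank, strand by strand -/

section StringBasis

variable {k V ι : Type*} [Field k] [AddCommGroup V] [Module k V]

/-- A basis `e s p q`, `p < m s`, `q < d`, of `V`, homogeneous of degrees `a s + p + q`. The vectors
`e s p q` with `p` or `q` out of range are zero. -/
structure IsStringBasis (a m : ι → ℕ) (d : ℕ) (𝒱 : ℕ → Submodule k V) (e : ι → ℕ → ℕ → V) :
    Prop where
  eq_zero_left : ∀ s p q, m s ≤ p → e s p q = 0
  eq_zero_right : ∀ s p q, d ≤ q → e s p q = 0
  linearIndependent :
    LinearIndependent k (fun x : (Σ s, Fin (m s)) × Fin d => e x.1.1 x.1.2 x.2)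
  span_eq_top : Submodule.span k {w | ∃ s p q, e s p q = w} = ⊤
  grading_eq : ∀ n, 𝒱 n = Submodule.span k {w | ∃ s p q, a s + p + q = n ∧ e s p q = w}

/-- The degree `n` part of the string `s`. -/
def strand (k : Type*) {V ι : Type*} [Field k] [AddCommGroup V] [Module k V]
    (a : ι → ℕ) (e : ι → ℕ → ℕ → V) (s : ι) (n : ℕ) : Submodule k V :=
  Submodule.span k {w | ∃ p q, a s + p + q = n ∧ e s p q = w}

/-- The number of basis vectors of degree `n` in a string starting in degree `a`. -/
def strandCount (a m d n : ℕ) : ℕ :=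
  ((Finset.range m).filter fun p => a + p ≤ n ∧ n < a + p + d).card

theorem mem_strand {a : ι → ℕ} {e : ι → ℕ → ℕ → V} {s : ι} {p q n : ℕ} (h : a s + p + q = n) :
    e s p q ∈ strand k a e s n :=
  Submodule.subset_span ⟨p, q, h, rfl⟩

theorem strand_le {a : ι → ℕ} {e : ι → ℕ → ℕ → V} {s : ι} {n : ℕ} {S : Submodule k V}
    (h : ∀ p q, a s + p + q = n → e s p q ∈ S) : strand k a e s n ≤ S := by
  refine Submodule.span_le.2 ?_
  rintro _ ⟨p, q, hpq, rfl⟩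
  exact h p q hpq

namespace IsStringBasis

variable {a m : ι → ℕ} {d : ℕ} {𝒱 : ℕ → Submodule k V} {e : ι → ℕ → ℕ → V}

theorem strand_le_grading (h : IsStringBasis a m d 𝒱 e) (s : ι) (n : ℕ) :
    strand k a e s n ≤ 𝒱 n := by
  rw [h.grading_eq]
  exact strand_le fun p q hpq => Submodule.subset_span ⟨s, p, q, hpq, rfl⟩

theorem grading_le (h : IsStringBasis a m d 𝒱 e) {n : ℕ} {S : Submodule k V}
    (hS : ∀ s, strand k a e s n ≤ S) : 𝒱 n ≤ S := by
  rw [h.grading_eq, Submodule.span_le]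
  rintro _ ⟨s, p, q, hpq, rfl⟩
  exact hS s (mem_strand hpq)

theorem hom_ext (h : IsStringBasis a m d 𝒱 e) {V' : Type*} [AddCommGroup V'] [Module k V']
    {f g : V →ₗ[k] V'} (hfg : ∀ s p q, f (e s p q) = g (e s p q)) : f = g := by
  refine LinearMap.ext_on h.span_eq_top ?_
  rintro _ ⟨s, p, q, rfl⟩
  exact hfg s p q

theorem exists_linearMap (h : IsStringBasis a m d 𝒱 e) {V' : Type*} [AddCommGroup V'] [Module k V']
    (g : ι → ℕ → ℕ → V') (hl : ∀ s p q, m s ≤ p → g s p q = 0)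
    (hr : ∀ s p q, d ≤ q → g s p q = 0) :
    ∃ f : V →ₗ[k] V', ∀ s p q, f (e s p q) = g s p q := by
  have htop : ⊤ ≤ Submodule.span k
      (Set.range fun x : (Σ s, Fin (m s)) × Fin d => e x.1.1 x.1.2 x.2) := by
    rw [← h.span_eq_top, Submodule.span_le]
    rintro _ ⟨s, p, q, rfl⟩
    rcases le_or_gt (m s) p with hp | hp
    · rw [h.eq_zero_left s p q hp]
      exact zero_mem _
    rcases le_or_gt d q with hq | hq
    · rw [h.eq_zero_right s p q hq]
      exact zero_mem _
    exact Submodule.subset_span ⟨(⟨s, ⟨p, hp⟩⟩, ⟨q, hq⟩), rfl⟩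
  refine ⟨(Module.Basis.mk h.linearIndependent htop).constr k fun x => g x.1.1 x.1.2 x.2,
    fun s p q => ?_⟩
  rcases le_or_gt (m s) p with hp | hp
  · rw [h.eq_zero_left s p q hp, hl s p q hp, map_zero]
  rcases le_or_gt d q with hq | hq
  · rw [h.eq_zero_right s p q hq, hr s p q hq, map_zero]
  have := (Module.Basis.mk h.linearIndependent htop).constr_basis k
    (fun x => g x.1.1 x.1.2 x.2) (⟨s, ⟨p, hp⟩⟩, ⟨q, hq⟩)
  simpa using this

theorem exists_proj [DecidableEq ι] (h : IsStringBasis a m d 𝒱 e) (s : ι) :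
    ∃ π : V →ₗ[k] V, ∀ s' p q, π (e s' p q) = if s' = s then e s' p q else 0 :=
  h.exists_linearMap (fun s' p q => if s' = s then e s' p q else 0)
    (fun s' p q hp => by simp [h.eq_zero_left s' p q hp])
    (fun s' p q hq => by simp [h.eq_zero_right s' p q hq])

theorem strand_eq_bot (h : IsStringBasis a m d 𝒱 e) (s : ι) {n : ℕ} (hn : a s + m s + d ≤ n) :
    strand k a e s n = ⊥ := by
  refine le_bot_iff.1 (strand_le fun p q hpq => ?_)
  rw [Submodule.mem_bot]
  rcases le_or_gt (m s) p with hp | hp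
  · exact h.eq_zero_left s p q hp
  · exact h.eq_zero_right s p q (by omega)

theorem finrank_strand (h : IsStringBasis a m d 𝒱 e) (s : ι) (n : ℕ) :
    Module.finrank k (strand k a e s n) = strandCount (a s) (m s) d n := by
  set S := (Finset.range (m s)).filter fun p => a s + p ≤ n ∧ n < a s + p + d with hS
  have hmem : ∀ p : S, (p : ℕ) < m s ∧ a s + p ≤ n ∧ n < a s + p + d := fun p =>
    ⟨Finset.mem_range.1 (Finset.mem_filter.1 p.2).1, (Finset.mem_filter.1 p.2).2⟩
  have hli : LinearIndependent k (fun p : S => e s p (n - a s - p)) := by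
    refine h.linearIndependent.comp (fun p : S => (⟨s, ⟨p, (hmem p).1⟩⟩, ⟨n - a s - p, by
      have := hmem p; omega⟩)) ?_
    intro p q hpq
    simp only [Prod.mk.injEq, Sigma.mk.injEq, heq_eq_eq, Fin.mk.injEq, true_and] at hpq
    exact Subtype.ext hpq.1
  have hspan : strand k a e s n = Submodule.span k (Set.range fun p : S => e s p (n - a s - p)) := by
    refine le_antisymm (strand_le fun p q hpq => ?_) (Submodule.span_le.2 ?_)
    · rcases le_or_gt (m s) p with hp | hp
      · rw [h.eq_zero_left s p q hp]
        exact zero_mem _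
      rcases le_or_gt d q with hq | hq
      · rw [h.eq_zero_right s p q hq]
        exact zero_mem _
      refine Submodule.subset_span ⟨⟨p, ?_⟩, ?_⟩
      · simp only [hS, Finset.mem_filter, Finset.mem_range]
        omega
      · simp only
        congr 1
        omega
    · rintro _ ⟨p, rfl⟩
      have := hmem p
      exact mem_strand (by omega)
  rw [hspan, finrank_span_eq_card hli, Fintype.card_coe]
  rfl

section FullRank

variable {E : Module.End k V} {c : k}

theorem raise_mem_strand
    (hE : ∀ s p q, E (e s p q) = e s (p + 1) q + c • e s p (q + 1)) (s : ι) (i : ℕ) :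
    ∀ v ∈ strand k a e s i, E v ∈ strand k a e s (i + 1) := by
  refine fun v hv => strand_le (S := (strand k a e s (i + 1)).comap E) (fun p q hpq => ?_) hv
  rw [Submodule.mem_comap, hE]
  exact add_mem (mem_strand (by omega)) (Submodule.smul_mem _ _ (mem_strand (by omega)))

theorem proj_pow_raise [DecidableEq ι] (h : IsStringBasis a m d 𝒱 e)
    (hE : ∀ s p q, E (e s p q) = e s (p + 1) q + c • e s p (q + 1)) {s : ι} {π : V →ₗ[k] V}
    (hπ : ∀ s' p q, π (e s' p q) = if s' = s then e s' p q else 0) (t : ℕ) (v : V) :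
    π ((E ^ t) v) = (E ^ t) (π v) := by
  have hcomm : Commute π E := by
    refine h.hom_ext fun s' p q => ?_
    simp only [Module.End.mul_apply, hE, hπ, map_add, map_smul]
    split_ifs <;> simp [hE]
  exact LinearMap.congr_fun (hcomm.pow_right t).eq v

theorem proj_mem_strand [DecidableEq ι] (h : IsStringBasis a m d 𝒱 e) {s : ι} {π : V →ₗ[k] V}
    (hπ : ∀ s' p q, π (e s' p q) = if s' = s then e s' p q else 0) {n : ℕ} {v : V}
    (hv : v ∈ 𝒱 n) : π v ∈ strand k a e s n := by
  refine h.grading_le (S := (strand k a e s n).comap π) (fun s' => strand_le fun p q hpq => ?_) hv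
  rw [Submodule.mem_comap, hπ]
  split_ifs with hs
  · subst hs
    exact mem_strand hpq
  · exact zero_mem _

theorem proj_eq_self [DecidableEq ι] {s : ι} {π : V →ₗ[k] V}
    (hπ : ∀ s' p q, π (e s' p q) = if s' = s then e s' p q else 0) {n : ℕ} {v : V}
    (hv : v ∈ strand k a e s n) : π v = v := by
  refine strand_le (S := LinearMap.eqLocus π LinearMap.id) (fun p q hpq => ?_) hv
  simp [hπ]

theorem eq_zero_of_proj [Fintype ι] [DecidableEq ι] (h : IsStringBasis a m d 𝒱 e) {v : V}
    (hv : ∀ s, ∀ π : V →ₗ[k] V,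
      (∀ s' p q, π (e s' p q) = if s' = s then e s' p q else 0) → π v = 0) : v = 0 := by
  choose π hπ using h.exists_proj
  have hsum : ∑ s, π s = LinearMap.id := h.hom_ext fun s' p q => by simp [hπ]
  rw [← LinearMap.id_apply (R := k) v, ← hsum, LinearMap.sum_apply]
  exact Finset.sum_eq_zero fun s _ => hv s _ (hπ s)

/-- E preserves strands and commutes with the projections onto them, so injectivity or surjectivity
passes to each strand. The scalar c may be 0. -/
theorem strandCount_le_or_le [Module.Finite k V] (h : IsStringBasis a m d 𝒱 e)
    (hE : ∀ s p q, E (e s p q) = e s (p + 1) q + c • e s p (q + 1)) {t i : ℕ}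
    (hfull : Set.InjOn (E ^ t) (𝒱 i : Set V) ∨ Set.SurjOn (E ^ t) (𝒱 i : Set V) (𝒱 (i + t))) :
    (∀ s, strandCount (a s) (m s) d i ≤ strandCount (a s) (m s) d (i + t)) ∨
      (∀ s, strandCount (a s) (m s) d (i + t) ≤ strandCount (a s) (m s) d i) := by
  classical
  refine hfull.imp (fun hinj s => ?_) (fun hsurj s => ?_)
  · rw [← h.finrank_strand, ← h.finrank_strand]
    refine LinearMap.finrank_le_finrank_of_injective
      (f := (E ^ t).restrict fun v hv => pow_raise_mem (raise_mem_strand hE s) t i hv) ?_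
    intro v w hvw
    exact Subtype.ext (hinj (h.strand_le_grading s i v.2) (h.strand_le_grading s i w.2)
      (congrArg Subtype.val hvw))
  · obtain ⟨π, hπ⟩ := h.exists_proj s
    rw [← h.finrank_strand, ← h.finrank_strand]
    have hle : strand k a e s (i + t) ≤ (strand k a e s i).map (E ^ t) := by
      intro w hw
      obtain ⟨u, hu, huw⟩ := hsurj (h.strand_le_grading s _ hw)
      refine ⟨π u, h.proj_mem_strand hπ hu, ?_⟩
      rw [← h.proj_pow_raise hE hπ, huw, proj_eq_self hπ hw]
    exact (Submodule.finrank_mono hle).trans (Submodule.finrank_map_le _ _)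

theorem exists_lower (h : IsStringBasis a m d 𝒱 e)
    (hE : ∀ s p q, E (e s p q) = e s (p + 1) q + e s p (q + 1)) :
    ∃ F : Module.End k V, ∀ s,
      IsGradedSlTwo (strand k a e s) E F (2 * a s + m s + d) := by
  obtain ⟨F, hF⟩ := h.exists_linearMap
    -- The tensor product of the standard lowering operators. The coefficients vanish at p = 0, p =
    -- m, q = 0 and q = d, so truncated subtraction and out-of-range vectors do no harm.
    (fun s p q => ((p : k) * (m s - p)) • e s (p - 1) q + ((q : k) * (d - q)) • e s p (q - 1))
    (fun s p q hp => by
      rw [h.eq_zero_left s p _ hp, smul_zero, add_zero]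
      rcases hp.eq_or_lt with hp | hp
      · simp [hp]
      · rw [h.eq_zero_left s (p - 1) q (by omega), smul_zero])
    (fun s p q hq => by
      rw [h.eq_zero_right s _ q hq, smul_zero, zero_add]
      rcases hq.eq_or_lt with hq | hq
      · simp [hq]
      · rw [h.eq_zero_right s p (q - 1) (by omega), smul_zero])
  refine ⟨F, fun s => ⟨raise_mem_strand (c := 1) (by simpa using hE) s, fun i v hv => ?_,
    fun v hv => ?_, fun i v hv => ?_⟩⟩
  · refine strand_le (S := (strand k a e s i).comap F) (fun p q hpq => ?_) hv
    rw [Submodule.mem_comap, hF]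
    refine add_mem ?_ ?_
    · rcases p with _ | p
      · simp
      · exact Submodule.smul_mem _ _ (mem_strand (by simp; omega))
    · rcases q with _ | q
      · simp
      · exact Submodule.smul_mem _ _ (mem_strand (by simp; omega))
  · refine strand_le (S := LinearMap.ker F) (fun p q hpq => ?_) hv
    obtain rfl : p = 0 := by omega
    obtain rfl : q = 0 := by omega
    simp [hF]
  · refine strand_le (S := LinearMap.eqLocus (E * F)
      (F * E + ((2 * i + 2 : k) - (2 * a s + m s + d : ℕ)) • LinearMap.id)) (fun p q hpq => ?_) hv
    subst hpq
    have h1 : ∀ q' : ℕ, (p : k) • e s (p - 1 + 1) q' = (p : k) • e s p q' := fun q' => by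
      rcases p with _ | p <;> simp
    have h2 : ∀ p' : ℕ, (q : k) • e s p' (q - 1 + 1) = (q : k) • e s p' q := fun q' => by
      rcases q with _ | q <;> simp
    simp only [LinearMap.mem_eqLocus, Module.End.mul_apply, LinearMap.add_apply,
      LinearMap.smul_apply, LinearMap.id_apply, hE, hF, map_add, map_smul, add_tsub_cancel_right,
      mul_comm (p : k), mul_comm (q : k), mul_smul, smul_add, h1, h2]
    push_cast
    module

/-- If injectivity fails its bound on one strand, then 2i + t + 2 exceeds that strand's μ by at
least 1, hence is at least every other μ, and all strands are surjective. -/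
theorem injOn_or_surjOn [CharZero k] [Fintype ι] (h : IsStringBasis a m d 𝒱 e)
    (hE : ∀ s p q, E (e s p q) = e s (p + 1) q + e s p (q + 1))
    (hc : ∀ s s', 2 * a s + m s ≤ 2 * a s' + m s' + 1) (t i : ℕ) :
    Set.InjOn (E ^ t) (𝒱 i : Set V) ∨ Set.SurjOn (E ^ t) (𝒱 i : Set V) (𝒱 (i + t)) := by
  classical
  obtain ⟨F, hF⟩ := h.exists_lower hE
  by_cases hi : ∀ s, 2 * i + t + 2 ≤ 2 * a s + m s + d
  · refine Or.inl fun v hv w hw hvw => ?_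
    rw [← sub_eq_zero]
    refine h.eq_zero_of_proj fun s π hπ => ?_
    refine (hF s).pow_raise_eq_zero (hi s) (h.proj_mem_strand hπ (sub_mem hv hw)) (t := t) ?_
    rw [← h.proj_pow_raise (c := 1) (by simpa using hE) hπ, map_sub, hvw, sub_self, map_zero]
  · push Not at hi
    obtain ⟨s₀, hs₀⟩ := hi
    refine Or.inr ?_
    suffices 𝒱 (i + t) ≤ (𝒱 i).map (E ^ t) from this
    refine h.grading_le fun s w hw => ?_
    have := hc s s₀
    obtain ⟨u, hu, huw⟩ := (hF s).exists_pow_raise_eq (D := a s + m s + d)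
      (fun n hn => h.strand_eq_bot s hn) (by omega) hw
    exact ⟨u, h.strand_le_grading s i hu, huw⟩

end FullRank

end IsStringBasis

end StringBasis

/-! ### Graded Jordan decomposition for a linear form -/

section Strings

variable {k B : Type*} [Field k] [CommRing B] [Algebra k B]

theorem IsStandardGraded.finite [IsArtinianRing B] {𝒜 : ℕ → Submodule k B} [GradedAlgebra 𝒜]
    (h𝒜 : IsStandardGraded 𝒜) : Module.Finite k B := by
  have hft : Algebra.FiniteType k B := by
    obtain ⟨S, hS⟩ := (Module.Finite.iff_fg.1 h𝒜.finite_degree_one)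
    refine ⟨S, top_le_iff.1 ?_⟩
    rw [← h𝒜.generated, ← hS]
    exact Algebra.adjoin_le (Algebra.span_le_adjoin k _)
  exact Module.finite_of_isArtinianRing k B

theorem exists_grading_eq_bot [Module.Finite k B] (𝒜 : ℕ → Submodule k B) [GradedAlgebra 𝒜] :
    ∃ D, ∀ n, D ≤ n → 𝒜 n = ⊥ := by
  have hfin := WellFoundedGT.finite_ne_bot_of_iSupIndep
    (DirectSum.Decomposition.isInternal 𝒜).submodule_iSupIndep
  obtain ⟨D, hD⟩ := hfin.bddAbove
  refine ⟨D + 1, fun n hn => ?_⟩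
  by_contra hne
  have := hD hne
  omega

theorem pow_mem_grading {𝒜 : ℕ → Submodule k B} [GradedAlgebra 𝒜] {ℓ : B} (hℓ : ℓ ∈ 𝒜 1) (n : ℕ) :
    ℓ ^ n ∈ 𝒜 n := by
  simpa using SetLike.pow_mem_graded n hℓ

theorem proj_proj (𝒜 : ℕ → Submodule k B) [GradedAlgebra 𝒜] (i j : ℕ) (u : B) :
    GradedAlgebra.proj 𝒜 i (GradedAlgebra.proj 𝒜 j u) =
      if j = i then GradedAlgebra.proj 𝒜 i u else 0 := by
  have hmem : GradedAlgebra.proj 𝒜 j u ∈ 𝒜 j := by simp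
  split_ifs with hij
  · subst hij
    exact DirectSum.decompose_of_mem_same 𝒜 hmem
  · exact DirectSum.decompose_of_mem_ne 𝒜 hmem hij

/-- v generates a longest string in U, and φ detects its last vector. The final clause says that φ
lives in a single degree; it makes the complement cut out by φ graded. -/
theorem exists_string_functional [Module.Finite k B] {𝒜 : ℕ → Submodule k B} [GradedAlgebra 𝒜]
    {ℓ : B} (hℓ : ℓ ∈ 𝒜 1) {U : Submodule k B} (hU : ∀ u ∈ U, ∀ i, GradedAlgebra.proj 𝒜 i u ∈ U)
    (hU0 : U ≠ ⊥) :
    ∃ (n a : ℕ) (v : B) (φ : B →ₗ[k] k), (∀ u ∈ U, ℓ ^ (n + 1) * u = 0) ∧ v ∈ U ∧ v ∈ 𝒜 a ∧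
      (∀ j, φ (ℓ ^ j * v) = if j = n then 1 else 0) ∧
      ∀ u i, φ u = φ (GradedAlgebra.proj 𝒜 i u) ∨ φ (GradedAlgebra.proj 𝒜 i u) = 0 := by
  classical
  have hex : ∃ m, ∀ u ∈ U, ℓ ^ m * u = 0 := by
    obtain ⟨D, hD⟩ := exists_grading_eq_bot 𝒜
    refine ⟨D, fun u _ => ?_⟩
    have := pow_mem_grading hℓ D
    rw [hD D le_rfl, Submodule.mem_bot] at this
    rw [this, zero_mul]
  obtain ⟨n, hn⟩ : ∃ n, Nat.find hex = n + 1 := by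
    refine Nat.exists_eq_succ_of_ne_zero fun h0 => hU0 ?_
    have := Nat.find_spec hex
    rw [h0] at this
    exact (Submodule.eq_bot_iff _).2 fun u hu => by simpa using this u hu
  have hzero : ∀ u ∈ U, ℓ ^ (n + 1) * u = 0 := hn ▸ Nat.find_spec hex
  have hmin := Nat.find_min hex (m := n) (by omega)
  push Not at hmin
  obtain ⟨u, hu, hne⟩ := hmin
  obtain ⟨a, ha⟩ : ∃ a, ℓ ^ n * GradedAlgebra.proj 𝒜 a u ≠ 0 := by
    by_contra! hall
    refine hne ?_
    rw [← DirectSum.sum_support_decompose 𝒜 u, Finset.mul_sum]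
    exact Finset.sum_eq_zero fun i _ => hall i
  obtain ⟨φ₀, hφ₀⟩ : ∃ φ₀ : Module.Dual k B, φ₀ (ℓ ^ n * GradedAlgebra.proj 𝒜 a u) ≠ 0 := by
    by_contra! hall
    exact ha ((Module.forall_dual_apply_eq_zero_iff k _).1 hall)
  set v := GradedAlgebra.proj 𝒜 a u with hv
  have hva : v ∈ 𝒜 a := by simp [hv]
  have hpow : ∀ j, ℓ ^ j * v ∈ 𝒜 (j + a) := fun j => SetLike.mul_mem_graded (pow_mem_grading hℓ j) hva
  refine ⟨n, a, v, (φ₀ (ℓ ^ n * v))⁻¹ • φ₀ ∘ₗ GradedAlgebra.proj 𝒜 (n + a), hzero, hU u hu a, hva,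
    fun j => ?_, fun w i => ?_⟩
  · have hproj : GradedAlgebra.proj 𝒜 (n + a) (ℓ ^ j * v) = if j = n then ℓ ^ j * v else 0 := by
      split_ifs with hj
      · subst hj
        exact DirectSum.decompose_of_mem_same 𝒜 (hpow j)
      · exact DirectSum.decompose_of_mem_ne 𝒜 (hpow j) (by omega)
    rw [LinearMap.smul_apply, LinearMap.comp_apply, hproj]
    split_ifs with hj
    · subst hj
      exact inv_mul_cancel₀ hφ₀
    · simp
  · simp only [LinearMap.smul_apply, LinearMap.comp_apply, proj_proj]
    split_ifs with hi
    · exact Or.inl rfl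
    · exact Or.inr (by simp)

theorem exists_string_family [Module.Finite k B] {𝒜 : ℕ → Submodule k B} [GradedAlgebra 𝒜]
    {ℓ : B} (hℓ : ℓ ∈ 𝒜 1) (U : Submodule k B) (hU : ∀ u ∈ U, ∀ i, GradedAlgebra.proj 𝒜 i u ∈ U)
    (hℓU : ∀ u ∈ U, ℓ * u ∈ U) :
    ∃ (ι : Type) (_ : Fintype ι) (a m : ι → ℕ) (v : ι → B), (∀ s, 0 < m s) ∧
      (∀ s, v s ∈ 𝒜 (a s)) ∧ (∀ s, ℓ ^ m s * v s = 0) ∧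
      LinearIndependent k (fun x : Σ s, Fin (m s) => ℓ ^ (x.2 : ℕ) * v x.1) ∧
      Submodule.span k (Set.range fun x : Σ s, Fin (m s) => ℓ ^ (x.2 : ℕ) * v x.1) = U := by
  induction U using WellFoundedLT.induction with
  | ind U ih =>
  rcases eq_or_ne U ⊥ with rfl | hU0
  · refine ⟨Empty, inferInstance, Empty.elim, Empty.elim, Empty.elim, nofun, nofun, nofun,
      linearIndependent_empty_type, ?_⟩
    rw [Set.range_eq_empty, Submodule.span_empty]
  obtain ⟨n, a, v, φ, hn, hvU, hva, hφ, hproj⟩ := exists_string_functional hℓ hU hU0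
  have hpowU : ∀ j, ∀ u ∈ U, ℓ ^ j * u ∈ U := fun j u hu => by
    induction j with
    | zero => simpa using hu
    | succ j ihj =>
      rw [pow_succ', mul_assoc]
      exact hℓU _ ihj
  have hlarge : ∀ j, n < j → ∀ u ∈ U, ℓ ^ j * u = 0 := fun j hj u hu => by
    obtain ⟨c, rfl⟩ := Nat.exists_eq_add_of_le hj
    rw [add_comm, pow_add, mul_assoc, hn u hu, mul_zero]
  -- The largest ℓ-stable subspace of U inside ker φ: a graded complement of the string of v, to
  -- which induction applies.
  let U' : Submodule k B := U ⊓ ⨅ j : ℕ, LinearMap.ker (φ ∘ₗ LinearMap.mulLeft k (ℓ ^ j))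
  have hU' : ∀ u, u ∈ U' ↔ u ∈ U ∧ ∀ j : ℕ, φ (ℓ ^ j * u) = 0 := fun u => by
    simp [U', Submodule.mem_iInf]
  obtain ⟨ι, hι, a', m', v', hm', hva', hz', hli', hspan'⟩ := ih U'
    (lt_of_le_of_ne inf_le_left fun heq => by
      have := ((hU' v).1 (heq ▸ hvU)).2 n
      rw [hφ, if_pos rfl] at this
      exact one_ne_zero this)
    (fun u hu i => by
      rw [hU'] at hu ⊢
      refine ⟨hU u hu.1 i, fun j => ?_⟩
      have hmul : ℓ ^ j * GradedAlgebra.proj 𝒜 i u = GradedAlgebra.proj 𝒜 (j + i) (ℓ ^ j * u) :=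
        (DirectSum.coe_decompose_mul_add_of_left_mem 𝒜 (pow_mem_grading hℓ j)).symm
      rw [hmul]
      rcases hproj (ℓ ^ j * u) (j + i) with h | h
      · rw [← h, hu.2 j]
      · exact h)
    (fun u hu => by
      rw [hU'] at hu ⊢
      refine ⟨hℓU u hu.1, fun j => ?_⟩
      rw [← mul_assoc, ← pow_succ]
      exact hu.2 _)
  have hmemU' : ∀ s (p : Fin (m' s)), ℓ ^ (p : ℕ) * v' s ∈ U' := fun s p =>
    hspan' ▸ Submodule.subset_span ⟨⟨s, p⟩, rfl⟩
  let m : Option ι → ℕ := fun s => s.elim (n + 1) m'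
  let w : Option ι → B := fun s => s.elim v v'
  refine ⟨Option ι, inferInstance, fun s => s.elim a a', m, w, ?_, ?_, ?_, ?_, ?_⟩
  · rintro (_ | s)
    exacts [n.succ_pos, hm' s]
  · rintro (_ | s)
    exacts [hva, hva' s]
  · rintro (_ | s)
    exacts [hn v hvU, hz' s]
  · rw [Fintype.linearIndependent_iff] at hli' ⊢
    intro g hg
    rw [Fintype.sum_sigma, Fintype.sum_option] at hg
    replace hg : ∑ p : Fin (n + 1), g ⟨none, p⟩ • (ℓ ^ (p : ℕ) * v) +
      ∑ s : ι, ∑ p : Fin (m' s), g ⟨some s, p⟩ • (ℓ ^ (p : ℕ) * v' s) = 0 := hg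
    have hrest : ∑ s : ι, ∑ p : Fin (m' s), g ⟨some s, p⟩ • (ℓ ^ (p : ℕ) * v' s) ∈ U' :=
      sum_mem fun s _ => sum_mem fun p _ => Submodule.smul_mem _ _ (hmemU' s p)
    have hnone : ∀ p : Fin (n + 1), g ⟨none, p⟩ = 0 := by
      intro p₀
      -- Multiplying by ℓ^(n-p₀) moves the term of index p₀ to the end of the string, the only place
      -- φ sees.
      have h := congrArg (fun x => φ (ℓ ^ (n - p₀ : ℕ) * x)) hg
      have h' := ((hU' _).1 hrest).2 (n - p₀)
      simp only [mul_add, map_add, mul_zero, map_zero] at h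
      rw [h', add_zero, Finset.mul_sum, map_sum] at h
      simp only [mul_smul_comm, map_smul, ← mul_assoc, ← pow_add, hφ] at h
      rw [Finset.sum_eq_single p₀] at h
      · rw [if_pos (by omega)] at h
        simpa using h
      · intro p _ hp
        rw [if_neg (by omega), smul_zero]
      · simp
    have hsome := hli' (fun x => g ⟨some x.1, x.2⟩) (by
      rw [Fintype.sum_sigma]
      simpa only [hnone, zero_smul, Finset.sum_const_zero, zero_add] using hg)
    rintro ⟨_ | s, p⟩
    exacts [hnone p, hsome ⟨s, p⟩]
  · refine le_antisymm (Submodule.span_le.2 ?_) fun u hu => ?_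
    · rintro _ ⟨⟨_ | s, p⟩, rfl⟩
      · exact hpowU _ v hvU
      · exact ((hU' _).1 (hmemU' s p)).1
    · have hsub : u - ∑ p ∈ Finset.range (n + 1), φ (ℓ ^ (n - p) * u) • (ℓ ^ p * v) ∈ U' := by
        rw [hU']
        refine ⟨sub_mem hu (sum_mem fun p _ => Submodule.smul_mem _ _ (hpowU p v hvU)), fun j => ?_⟩
        rw [mul_sub, map_sub, Finset.mul_sum, map_sum]
        simp only [mul_smul_comm, map_smul, ← mul_assoc, ← pow_add, hφ]
        rcases le_or_gt j n with hj | hj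
        · rw [Finset.sum_eq_single (n - j)]
          · rw [if_pos (by omega), show n - (n - j) = j by omega, smul_eq_mul, mul_one, sub_self]
          · intro p _ hp
            rw [if_neg (by omega), smul_zero]
          · intro h
            exact absurd (Finset.mem_range.2 (by omega)) h
        · rw [hlarge j hj u hu, map_zero, zero_sub, neg_eq_zero]
          exact Finset.sum_eq_zero fun p _ => by rw [if_neg (by omega), smul_zero]
      have hle : U' ≤ Submodule.span k
          (Set.range fun x : Σ s, Fin (m s) => ℓ ^ (x.2 : ℕ) * w x.1) := by
        rw [← hspan', Submodule.span_le]
        rintro _ ⟨⟨s, p⟩, rfl⟩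
        exact Submodule.subset_span ⟨⟨some s, p⟩, rfl⟩
      rw [← sub_add_cancel u (∑ p ∈ Finset.range (n + 1), φ (ℓ ^ (n - p) * u) • (ℓ ^ p * v))]
      refine add_mem (hle hsub) (sum_mem fun p hp => Submodule.smul_mem _ _ ?_)
      exact Submodule.subset_span ⟨⟨none, ⟨p, Finset.mem_range.1 hp⟩⟩, rfl⟩

/-- The strings `v s, ℓ * v s, ℓ ^ 2 * v s, …` form a basis of `B`. -/
theorem exists_isStringBasis [Module.Finite k B] {𝒜 : ℕ → Submodule k B} [GradedAlgebra 𝒜]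
    {ℓ : B} (hℓ : ℓ ∈ 𝒜 1) :
    ∃ (ι : Type) (_ : Fintype ι) (a m : ι → ℕ) (v : ι → B), (∀ s, 0 < m s) ∧
      IsStringBasis a m 1 𝒜 (fun s p q => if q = 0 then ℓ ^ p * v s else 0) := by
  obtain ⟨ι, hι, a, m, v, hm, hva, hz, hli, hspan⟩ := exists_string_family hℓ ⊤
    (fun _ _ _ => Submodule.mem_top) (fun _ _ => Submodule.mem_top)
  have hpow : ∀ s p, ℓ ^ p * v s ∈ 𝒜 (a s + p) := fun s p => by
    rw [add_comm]
    exact SetLike.mul_mem_graded (pow_mem_grading hℓ p) (hva s)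
  refine ⟨ι, hι, a, m, v, hm, fun s p q hp => ?_, fun s p q hq => if_neg (by omega), ?_, ?_, ?_⟩
  · obtain ⟨c, rfl⟩ := Nat.exists_eq_add_of_le hp
    rw [add_comm, pow_add, mul_assoc, hz, mul_zero, ite_self]
  · have hcomp : (fun x : (Σ s, Fin (m s)) × Fin 1 =>
        if (x.2 : ℕ) = 0 then ℓ ^ (x.1.2 : ℕ) * v x.1.1 else 0) =
        (fun x : Σ s, Fin (m s) => ℓ ^ (x.2 : ℕ) * v x.1) ∘ Prod.fst := by
      ext x
      simp
    rw [hcomp]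
    refine hli.comp _ ?_
    rintro ⟨x, i⟩ ⟨y, j⟩ rfl
    rw [Subsingleton.elim i j]
  · rw [← top_le_iff, ← hspan, Submodule.span_le]
    rintro _ ⟨⟨s, p⟩, rfl⟩
    exact Submodule.subset_span ⟨s, p, 0, if_pos rfl⟩
  · intro n
    refine le_antisymm (fun u hu => ?_) (Submodule.span_le.2 ?_)
    · rw [show u = GradedAlgebra.proj 𝒜 n u from (DirectSum.decompose_of_mem_same 𝒜 hu).symm]
      have htop : u ∈ Submodule.span k _ := hspan ▸ Submodule.mem_top
      rw [← Submodule.mem_comap]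
      refine Submodule.span_le.2 ?_ htop
      rintro _ ⟨⟨s, p⟩, rfl⟩
      rcases eq_or_ne (a s + p) n with h | h
      · refine Submodule.subset_span ⟨s, p, 0, h, ?_⟩
        rw [if_pos rfl]
        exact (DirectSum.decompose_of_mem_same 𝒜 (h ▸ hpow s p)).symm
      · have : GradedAlgebra.proj 𝒜 n (ℓ ^ (p : ℕ) * v s) = 0 :=
          DirectSum.decompose_of_mem_ne 𝒜 (hpow s p) h
        exact (congrArg (· ∈ Submodule.span k _) this).mpr (zero_mem _)
    · rintro _ ⟨s, p, q, hpq, rfl⟩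
      split_ifs with hq
      · subst hq
        exact hpq ▸ hpow s p
      · exact zero_mem _

end Strings

/-! ### Tensoring with k[x]/(x^d) -/

section Truncated

variable {k : Type*} [Field k]

/-- The basis `1, x, …, x ^ (d - 1)` of `AdjoinRoot (X ^ d)`. -/
noncomputable def adjoinRootBasis (k : Type*) [Field k] (d : ℕ) :
    Module.Basis (Fin d) k (AdjoinRoot ((Polynomial.X : k[X]) ^ d)) :=
  (AdjoinRoot.powerBasis' (Polynomial.monic_X_pow (R := k) d)).basis.reindex
    (finCongr ((AdjoinRoot.powerBasis'_dim (Polynomial.monic_X_pow d)).trans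
      (Polynomial.natDegree_X_pow d)))

theorem adjoinRootBasis_apply (d : ℕ) (q : Fin d) :
    adjoinRootBasis k d q = AdjoinRoot.mk _ (Polynomial.X ^ (q : ℕ)) := by
  rw [adjoinRootBasis, Module.Basis.reindex_apply, PowerBasis.basis_eq_pow, map_pow]
  rfl

/-- The basis `1, x, …, x ^ (d - 1)` of `k[x]/(x^d)`. -/
noncomputable def truncPolyBasis (k : Type*) [Field k] (d : ℕ) :
    Module.Basis (Fin d) k (TruncPoly k d) :=
  adjoinRootBasis k d

theorem truncPolyBasis_apply (d : ℕ) (q : Fin d) :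
    truncPolyBasis k d q =
      Ideal.Quotient.mk (Ideal.span {(Polynomial.X : k[X]) ^ d}) (Polynomial.X ^ (q : ℕ)) :=
  adjoinRootBasis_apply d q

theorem mk_X_pow_eq_zero {d q : ℕ} (h : d ≤ q) :
    Ideal.Quotient.mk (Ideal.span {(Polynomial.X : k[X]) ^ d}) (Polynomial.X ^ q) = 0 :=
  Ideal.Quotient.eq_zero_iff_mem.2 (Ideal.mem_span_singleton.2 (pow_dvd_pow _ h))

theorem span_mk_X_pow (d : ℕ) :
    Submodule.span k {w | ∃ q, Ideal.Quotient.mk (Ideal.span {(Polynomial.X : k[X]) ^ d})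
      (Polynomial.X ^ q) = w} = ⊤ := by
  rw [← top_le_iff, ← (truncPolyBasis k d).span_eq, Submodule.span_le]
  rintro _ ⟨q, rfl⟩
  exact Submodule.subset_span ⟨q, (truncPolyBasis_apply d q).symm⟩

variable {B : Type*} [CommRing B] [Algebra k B] {ι : Type*}

theorem IsStringBasis.tensor {a m : ι → ℕ} {𝒜 : ℕ → Submodule k B} {f : ι → ℕ → B}
    (h : IsStringBasis a m 1 𝒜 (fun s p q => if q = 0 then f s p else 0)) (d : ℕ) :
    IsStringBasis a m d (tensorGrading 𝒜 (truncPolyGrading k d))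
      (fun s p q => f s p ⊗ₜ[k]
        Ideal.Quotient.mk (Ideal.span {(Polynomial.X : k[X]) ^ d}) (Polynomial.X ^ q)) := by
  refine ⟨fun s p q hp => ?_, fun s p q hq => ?_, ?_, ?_, fun n => ?_⟩
  · have := h.eq_zero_left s p 0 hp
    rw [if_pos rfl] at this
    rw [this, TensorProduct.zero_tmul]
  · rw [mk_X_pow_eq_zero hq, TensorProduct.tmul_zero]
  · have hB : LinearIndependent k (fun x : Σ s, Fin (m s) => f x.1 x.2) := by
      have := h.linearIndependent.comp (fun x : Σ s, Fin (m s) => (x, (0 : Fin 1)))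
        fun x y hxy => (Prod.mk.inj hxy).1
      simpa [Function.comp_def] using this
    have := hB.tmul_of_isDomain (truncPolyBasis k d).linearIndependent
    simpa only [truncPolyBasis_apply] using this
  · rw [← top_le_iff, ← TensorProduct.map₂_mk_top_top_eq_top, ← h.span_eq_top, ← span_mk_X_pow,
      Submodule.map₂_span_span, Submodule.span_le]
    rintro _ ⟨_, ⟨s, p, q', rfl⟩, _, ⟨q, rfl⟩, rfl⟩
    dsimp only
    split_ifs
    · exact Submodule.subset_span ⟨s, p, q, rfl⟩
    · rw [map_zero, LinearMap.zero_apply]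
      exact zero_mem _
  · refine le_antisymm ?_ (Submodule.span_le.2 ?_)
    · refine iSup_le fun i => iSup_le fun j => iSup_le fun hij => ?_
      rw [h.grading_eq, truncPolyGrading, Submodule.map₂_span_span, Submodule.span_le]
      rintro _ ⟨_, ⟨s, p, q, hpq, rfl⟩, _, rfl, rfl⟩
      dsimp only
      split_ifs with hq
      · exact Submodule.subset_span ⟨s, p, j, by omega, rfl⟩
      · rw [map_zero, LinearMap.zero_apply]
        exact zero_mem _
    · rintro _ ⟨s, p, q, hpq, rfl⟩
      refine Submodule.mem_iSup_of_mem (a s + p) (Submodule.mem_iSup_of_mem q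
        (Submodule.mem_iSup_of_mem hpq (Submodule.apply_mem_map₂ _ ?_
          (Submodule.mem_span_singleton_self _))))
      rw [h.grading_eq]
      exact Submodule.subset_span ⟨s, p, 0, rfl, if_pos rfl⟩

theorem mem_tensorGrading_one {𝒜 : ℕ → Submodule k B} (h0 : 𝒜 0 = Submodule.span k {(1 : B)})
    {d : ℕ} {z : B ⊗[k] TruncPoly k d} (hz : z ∈ tensorGrading 𝒜 (truncPolyGrading k d) 1) :
    ∃ ℓ ∈ 𝒜 1, ∃ c : k, z = ℓ ⊗ₜ[k] 1 + c • (1 : B) ⊗ₜ[k]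
      Ideal.Quotient.mk (Ideal.span {(Polynomial.X : k[X]) ^ d}) Polynomial.X := by
  have hle : tensorGrading 𝒜 (truncPolyGrading k d) 1 ≤
      (𝒜 1).map ((TensorProduct.mk k B (TruncPoly k d)).flip 1) ⊔
        Submodule.span k {(1 : B) ⊗ₜ[k]
          Ideal.Quotient.mk (Ideal.span {(Polynomial.X : k[X]) ^ d}) Polynomial.X} := by
    refine iSup_le fun i => iSup_le fun j => iSup_le fun hij => ?_
    obtain ⟨rfl, rfl⟩ | ⟨rfl, rfl⟩ : i = 0 ∧ j = 1 ∨ i = 1 ∧ j = 0 := by omega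
    · refine le_trans ?_ le_sup_right
      rw [h0, truncPolyGrading, Submodule.map₂_span_span, Submodule.span_le]
      rintro _ ⟨_, rfl, _, rfl, rfl⟩
      rw [pow_one]
      exact Submodule.mem_span_singleton_self _
    · refine le_trans ?_ le_sup_left
      rw [Submodule.map₂_le]
      intro b hb y hy
      obtain ⟨r, rfl⟩ := Submodule.mem_span_singleton.1 hy
      refine ⟨r • b, Submodule.smul_mem _ _ hb, ?_⟩
      simp
  obtain ⟨_, ⟨ℓ, hℓ, rfl⟩, y, hy, rfl⟩ := Submodule.mem_sup.1 (hle hz)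
  obtain ⟨c, rfl⟩ := Submodule.mem_span_singleton.1 hy
  exact ⟨ℓ, hℓ, c, rfl⟩

theorem add_mem_tensorGrading_one {𝒜 : ℕ → Submodule k B} [GradedAlgebra 𝒜] {ℓ : B} (hℓ : ℓ ∈ 𝒜 1)
    (d : ℕ) : ℓ ⊗ₜ[k] 1 + (1 : B) ⊗ₜ[k]
      Ideal.Quotient.mk (Ideal.span {(Polynomial.X : k[X]) ^ d}) Polynomial.X ∈
        tensorGrading 𝒜 (truncPolyGrading k d) 1 := by
  refine add_mem ?_ ?_
  · refine Submodule.mem_iSup_of_mem 1 (Submodule.mem_iSup_of_mem 0 (Submodule.mem_iSup_of_mem rfl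
      (Submodule.apply_mem_map₂ _ hℓ (Submodule.subset_span ?_))))
    simp
  · refine Submodule.mem_iSup_of_mem 0 (Submodule.mem_iSup_of_mem 1 (Submodule.mem_iSup_of_mem rfl
      (Submodule.apply_mem_map₂ _ SetLike.GradedOne.one_mem (Submodule.subset_span ?_))))
    simp

theorem mulHasFullRank_pow {A : Type*} [CommRing A] [Algebra k A] (z : A) (t : ℕ)
    (V W : Submodule k A) : MulHasFullRank (z ^ t) V W ↔
      Set.InjOn (LinearMap.mulLeft k z ^ t) (V : Set A) ∨
        Set.SurjOn (LinearMap.mulLeft k z ^ t) (V : Set A) (W : Set A) := by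
  rw [LinearMap.pow_mulLeft]
  rfl

end Truncated

/-! ### Numerical conditions on the strings -/

section Counting

/-- If the second center were too far right, two degrees would exist between which the first strand
strictly shrinks and the second strictly grows. -/
theorem center_le_of_strandCount {a m c n d : ℕ} (hm : 0 < m) (hn : 0 < n) (hmd : m ≤ d) (hnd : n ≤ d)
    (h : ∀ i t, strandCount a m d i ≤ strandCount a m d (i + t) ∨
      strandCount c n d (i + t) ≤ strandCount c n d i) : 2 * c + n ≤ 2 * a + m + 1 := by
  by_contra! hlt
  have key : ∀ i j, i ≤ j → strandCount a m d j < strandCount a m d i →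
      strandCount c n d j ≤ strandCount c n d i := fun i j hij hlt => by
    obtain ⟨t, rfl⟩ := Nat.exists_eq_add_of_le hij
    exact (h i t).resolve_left hlt.not_ge
  rcases lt_or_ge a c with hac | hca
  -- The degrees are a + r, still below the second strand, and c + n + d - 2, its top; the first
  -- count drops from at least r + 1 to at most r, also when the subtraction truncates to r = 0.
  · set r := a + m + 1 - c - n with hr
    have h1 : r + 1 ≤ strandCount a m d (a + r) := by
      rw [← Finset.card_range (r + 1)]
      refine Finset.card_le_card fun p hp => ?_
      rw [Finset.mem_range] at hp
      rw [Finset.mem_filter, Finset.mem_range]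
      omega
    have h2 : strandCount a m d (c + n + d - 2) ≤ m - (c + n - 1 - a) := by
      rw [← Nat.card_Ico (c + n - 1 - a) m]
      refine Finset.card_le_card fun p hp => ?_
      rw [Finset.mem_filter, Finset.mem_range] at hp
      rw [Finset.mem_Ico]
      omega
    have h3 : strandCount c n d (a + r) = 0 := by
      refine Finset.card_eq_zero.2 (Finset.filter_eq_empty_iff.2 fun p hp => ?_)
      omega
    have h4 : 0 < strandCount c n d (c + n + d - 2) :=
      Finset.card_pos.2 ⟨n - 1, Finset.mem_filter.2 ⟨Finset.mem_range.2 (by omega), by omega⟩⟩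
    have := key (a + r) (c + n + d - 2) (by omega) (by omega)
    omega
  -- The degrees are a, the bottom of the first strand, and a + m - 1 + d, just past its top.
  · have h1 : 0 < strandCount a m d a :=
      Finset.card_pos.2 ⟨0, Finset.mem_filter.2 ⟨Finset.mem_range.2 hm, by omega⟩⟩
    have h2 : strandCount a m d (a + m - 1 + d) = 0 := by
      refine Finset.card_eq_zero.2 (Finset.filter_eq_empty_iff.2 fun p hp => ?_)
      have := Finset.mem_range.1 hp
      omega
    have h3 : strandCount c n d a ≤ a - c + 1 := by
      rw [← Finset.card_range (a - c + 1)]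
      refine Finset.card_le_card fun p hp => ?_
      rw [Finset.mem_filter] at hp
      rw [Finset.mem_range]
      omega
    have h4 : n - (a + m - c) ≤ strandCount c n d (a + m - 1 + d) := by
      rw [← Nat.card_Ico (a + m - c) n]
      refine Finset.card_le_card fun p hp => ?_
      rw [Finset.mem_Ico] at hp
      rw [Finset.mem_filter, Finset.mem_range]
      omega
    have := key a (a + m - 1 + d) (by omega) (by omega)
    omega

variable {ι : Type*} [Fintype ι]

/-- The strings, starting in degrees `a s` and of lengths `m s`, that meet degree `z`. -/
def stringsAt (a m : ι → ℕ) (z : ℤ) : Finset ι :=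
  Finset.univ.filter fun s => (a s : ℤ) ≤ z ∧ z < a s + m s

theorem mem_stringsAt {a m : ι → ℕ} {z : ℤ} {s : ι} :
    s ∈ stringsAt a m z ↔ (a s : ℤ) ≤ z ∧ z < a s + m s := by
  simp [stringsAt]

theorem card_stringsAt_of_center_le {a m : ι → ℕ}
    (hc : ∀ s s', 2 * a s + m s ≤ 2 * a s' + m s' + 1) (i j : ℤ) (hij : i < j) :
    ((stringsAt a m i).card < (stringsAt a m j).card →
      ∀ u : ℕ, (stringsAt a m (i - u)).card ≤ (stringsAt a m (j + u)).card) ∧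
    ((stringsAt a m i).card > (stringsAt a m j).card →
      ∀ u : ℕ, (stringsAt a m (i - u)).card ≥ (stringsAt a m (j + u)).card) := by
  refine ⟨fun hlt u => ?_, fun hlt u => ?_⟩
  all_goals
    -- A string meeting only one of i, j bounds its own center relative to (i + j)/2, and by `hc`
    -- all centers up to 1/2; this carries each string to the reflected degree.
    obtain ⟨s', h1, h2⟩ := Finset.exists_mem_notMem_of_card_lt_card hlt
    refine Finset.card_le_card fun s hs => ?_
    rw [mem_stringsAt] at h1 h2 hs ⊢
    have := hc s s'
    have := hc s' s
    omega

theorem center_le_of_card_stringsAt {a m : ι → ℕ} (hm : ∀ s, 0 < m s)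
    (hnested : ∀ i j : ℤ, i ≤ j →
      stringsAt a m i ⊆ stringsAt a m j ∨ stringsAt a m j ⊆ stringsAt a m i)
    (hac : ∀ i j : ℤ, i < j → ((stringsAt a m i).card < (stringsAt a m j).card →
      ∀ u : ℕ, (stringsAt a m (i - u)).card ≤ (stringsAt a m (j + u)).card) ∧
    ((stringsAt a m i).card > (stringsAt a m j).card →
      ∀ u : ℕ, (stringsAt a m (i - u)).card ≥ (stringsAt a m (j + u)).card)) (s' s : ι) :
    2 * a s' + m s' ≤ 2 * a s + m s + 1 := by
  by_contra! hlt
  have hms := hm s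
  have hms' := hm s'
  have up : ∀ (i j : ℤ) (r : ι), i ≤ j → r ∈ stringsAt a m j → r ∉ stringsAt a m i →
      stringsAt a m i ⊂ stringsAt a m j := fun i j r hij hj hi =>
    ⟨(hnested i j hij).resolve_right fun h => hi (h hj), fun h => hi (h hj)⟩
  have down : ∀ (i j : ℤ) (r : ι), i ≤ j → r ∈ stringsAt a m i → r ∉ stringsAt a m j →
      stringsAt a m j ⊂ stringsAt a m i := fun i j r hij hi hj =>
    ⟨(hnested i j hij).resolve_left fun h => hj (h hi), fun h => hj (h hi)⟩
  rcases lt_or_ge (a s) (a s') with h1 | h1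
  · rcases lt_or_ge (a s + m s) (a s' + m s') with h2 | h2
    · have h3 := up (a s) (a s' + m s' - 1) s' (by omega) (by rw [mem_stringsAt]; omega)
        (by rw [mem_stringsAt]; omega)
      have h4 := down (a s) (a s' + m s' - 1) s (by omega) (by rw [mem_stringsAt]; omega)
        (by rw [mem_stringsAt]; omega)
      exact h3.2 h4.1
    -- Here s' lies inside s, off center: h rises across the start of s', but widening symmetrically
    -- until the left end reaches the start of s puts the right end past s, so h falls.
    · have h3 := Finset.card_lt_card (up (a s' - 1) (a s' + m s' - 1) s' (by omega)
        (by rw [mem_stringsAt]; omega) (by rw [mem_stringsAt]; omega))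
      have h4 := (hac _ _ (by omega)).1 h3 (a s' - 1 - a s)
      have h5 := Finset.card_lt_card (down
        (a s' - 1 - (a s' - 1 - a s : ℕ)) (a s' + m s' - 1 + (a s' - 1 - a s : ℕ)) s (by omega)
        (by rw [mem_stringsAt]; omega) (by rw [mem_stringsAt]; omega))
      omega
  -- Mirror case: h falls across the end of s, then rises once the right end is widened to the last
  -- degree of s'.
  · have h3 := Finset.card_lt_card (down (a s) (a s + m s) s (by omega)
      (by rw [mem_stringsAt]; omega) (by rw [mem_stringsAt]; omega))
    have h4 := (hac _ _ (by omega)).2 h3 (a s' + m s' - 1 - (a s + m s))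
    have h5 := Finset.card_lt_card (up
      (a s - (a s' + m s' - 1 - (a s + m s) : ℕ)) (a s + m s + (a s' + m s' - 1 - (a s + m s) : ℕ))
      s' (by omega) (by rw [mem_stringsAt]; omega) (by rw [mem_stringsAt]; omega))
    omega

theorem strandCount_one (a m n : ℕ) :
    strandCount a m 1 n = if a ≤ n ∧ n < a + m then 1 else 0 := by
  split_ifs with h
  · refine Finset.card_eq_one.2 ⟨n - a, ?_⟩
    ext p
    rw [Finset.mem_filter, Finset.mem_range, Finset.mem_singleton]
    omega
  · refine Finset.card_eq_zero.2 (Finset.filter_eq_empty_iff.2 fun p hp => ?_)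
    have := Finset.mem_range.1 hp
    omega

theorem stringsAt_nested {a m : ι → ℕ}
    (h : ∀ i t, (∀ s, strandCount (a s) (m s) 1 i ≤ strandCount (a s) (m s) 1 (i + t)) ∨
      (∀ s, strandCount (a s) (m s) 1 (i + t) ≤ strandCount (a s) (m s) 1 i)) (i j : ℤ)
    (hij : i ≤ j) : stringsAt a m i ⊆ stringsAt a m j ∨ stringsAt a m j ⊆ stringsAt a m i := by
  rcases lt_or_ge i 0 with hi | hi
  · refine Or.inl fun s hs => ?_
    rw [mem_stringsAt] at hs
    omega
  lift i to ℕ using hi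
  obtain ⟨t, rfl⟩ := Int.le.dest hij
  refine (h i t).imp (fun H s hs => ?_) (fun H s hs => ?_)
  all_goals
    have := H s
    rw [strandCount_one, strandCount_one] at this
    rw [mem_stringsAt] at hs ⊢
    split_ifs at this <;> omega

end Counting

/-! ### Hilbert function of a string basis and the main theorem -/

section Main

variable {k B ι : Type*} [Field k] [CommRing B] [Algebra k B]

theorem hilbertFn_eq_card [Fintype ι] {a m : ι → ℕ} {𝒜 : ℕ → Submodule k B} {e : ι → ℕ → ℕ → B}
    (h : IsStringBasis a m 1 𝒜 e) (z : ℤ) : hilbertFn 𝒜 z = (stringsAt a m z).card := by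
  rcases z with n | n
  · change Module.finrank k (𝒜 n) = _
    have hmem : ∀ s : stringsAt a m n, a s ≤ n ∧ n < a s + m s := fun s => by
      have := mem_stringsAt.1 s.2
      omega
    have hli : LinearIndependent k (fun s : stringsAt a m n => e s (n - a s) 0) := by
      refine h.linearIndependent.comp (fun s : stringsAt a m n =>
        (⟨s, ⟨n - a s, by have := hmem s; omega⟩⟩, (0 : Fin 1))) ?_
      intro s s' hs
      exact Subtype.ext (congrArg (fun x => x.1.1) hs)
    have hspan : 𝒜 n =
        Submodule.span k (Set.range fun s : stringsAt a m n => e s (n - a s) 0) := by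
      rw [h.grading_eq]
      refine le_antisymm (Submodule.span_le.2 ?_) (Submodule.span_le.2 ?_)
      · rintro _ ⟨s, p, q, hpq, rfl⟩
        rcases le_or_gt (m s) p with hp | hp
        · rw [h.eq_zero_left s p q hp]
          exact zero_mem _
        rcases Nat.eq_zero_or_pos q with rfl | hq
        · refine Submodule.subset_span ⟨⟨s, mem_stringsAt.2 (by omega)⟩, ?_⟩
          simp only
          congr 1
          omega
        · rw [h.eq_zero_right s p q hq]
          exact zero_mem _
      · rintro _ ⟨s, rfl⟩
        have := hmem s
        exact Submodule.subset_span ⟨s, n - a s, 0, by omega, rfl⟩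
    rw [hspan, finrank_span_eq_card hli, Fintype.card_coe]
    rfl
  · change 0 = _
    refine (Finset.card_eq_zero.2 (Finset.eq_empty_of_forall_notMem fun s hs => ?_)).symm
    have := mem_stringsAt.1 hs
    omega

theorem isAlmostCentered_iff [Fintype ι] {a m : ι → ℕ} {𝒜 : ℕ → Submodule k B} {e : ι → ℕ → ℕ → B}
    (h : IsStringBasis a m 1 𝒜 e) : IsAlmostCentered 𝒜 ↔ ∀ i j : ℤ, i < j →
      ((stringsAt a m i).card < (stringsAt a m j).card →
        ∀ u : ℕ, (stringsAt a m (i - u)).card ≤ (stringsAt a m (j + u)).card) ∧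
      ((stringsAt a m i).card > (stringsAt a m j).card →
        ∀ u : ℕ, (stringsAt a m (i - u)).card ≥ (stringsAt a m (j + u)).card) := by
  simp only [IsAlmostCentered, hilbertFn_eq_card h]

theorem mulLeft_string (ℓ : B) (v : ι → B) (c : k) (s : ι) (p q : ℕ) :
    LinearMap.mulLeft k ℓ (if q = 0 then ℓ ^ p * v s else 0) =
      (if q = 0 then ℓ ^ (p + 1) * v s else 0) +
        c • (if q + 1 = 0 then ℓ ^ p * v s else 0) := by
  rw [if_neg q.succ_ne_zero, smul_zero, add_zero, LinearMap.mulLeft_apply, mul_ite, mul_zero,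
    pow_succ', mul_assoc]

theorem mulLeft_tensor_string (ℓ : B) (v : ι → B) (d : ℕ) (c : k) (s : ι) (p q : ℕ) :
    LinearMap.mulLeft k (ℓ ⊗ₜ[k] 1 + c • (1 : B) ⊗ₜ[k]
        Ideal.Quotient.mk (Ideal.span {(Polynomial.X : k[X]) ^ d}) Polynomial.X)
      ((ℓ ^ p * v s) ⊗ₜ[k]
        Ideal.Quotient.mk (Ideal.span {(Polynomial.X : k[X]) ^ d}) (Polynomial.X ^ q)) =
      (ℓ ^ (p + 1) * v s) ⊗ₜ[k]
        Ideal.Quotient.mk (Ideal.span {(Polynomial.X : k[X]) ^ d}) (Polynomial.X ^ q) +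
      c • (ℓ ^ p * v s) ⊗ₜ[k]
        Ideal.Quotient.mk (Ideal.span {(Polynomial.X : k[X]) ^ d}) (Polynomial.X ^ (q + 1)) := by
  rw [LinearMap.mulLeft_apply, add_mul, smul_mul_assoc, Algebra.TensorProduct.tmul_mul_tmul,
    Algebra.TensorProduct.tmul_mul_tmul, one_mul, one_mul, ← mul_assoc, ← pow_succ', ← map_mul,
    ← pow_succ']

end Main

theorem theorem5p6 {k : Type*} [Field k] [CharZero k] {B : Type*} [CommRing B] [Algebra k B]
    [IsArtinianRing B] (𝒜 : ℕ → Submodule k B) [GradedAlgebra 𝒜] (h𝒜 : IsStandardGraded 𝒜) :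
    (∀ d : ℕ, 1 ≤ d → HasSLP (tensorGrading 𝒜 (truncPolyGrading k d))) ↔
      (IsAlmostCentered 𝒜 ∧ HasSLP 𝒜) := by
  have := h𝒜.finite
  constructor
  · intro hslp
    -- One d suffices, provided it is positive and at least every string length.
    set d := Module.finrank k B + 1 with hd
    have : Module.Finite k (TruncPoly k d) := .of_basis (truncPolyBasis k d)
    obtain ⟨z, hz, hfull⟩ := hslp d (by omega)
    obtain ⟨ℓ, hℓ, c, rfl⟩ := mem_tensorGrading_one h𝒜.degree_zero hz
    obtain ⟨ι, _, a, m, v, hm, hs⟩ := exists_isStringBasis hℓ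
    have hmd : ∀ s, m s ≤ d := fun s => by
      have hli := hs.linearIndependent.comp (fun p : Fin (m s) => (⟨s, p⟩, (0 : Fin 1)))
        fun p q hpq => by simpa using hpq
      have := hli.fintype_card_le_finrank
      rw [Fintype.card_fin] at this
      omega
    have hcount := fun i t => (hs.tensor d).strandCount_le_or_le (mulLeft_tensor_string ℓ v d c)
      ((mulHasFullRank_pow _ t _ _).1 (hfull t i))
    have hc : ∀ s s', 2 * a s + m s ≤ 2 * a s' + m s' + 1 := fun s s' =>
      center_le_of_strandCount (hm s') (hm s) (hmd s') (hmd s) fun i t =>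
        (hcount i t).imp (fun h => h s') (fun h => h s)
    refine ⟨(isAlmostCentered_iff hs).2 (card_stringsAt_of_center_le hc), ℓ, hℓ, fun t i => ?_⟩
    refine (mulHasFullRank_pow _ t _ _).2 (hs.injOn_or_surjOn (fun s p q => ?_) hc t i)
    simpa using mulLeft_string ℓ v (1 : k) s p q
  · rintro ⟨hac, ℓ, hℓ, hfull⟩ d -
    obtain ⟨ι, _, a, m, v, hm, hs⟩ := exists_isStringBasis hℓ
    have hc := center_le_of_card_stringsAt hm (stringsAt_nested fun i t =>
      hs.strandCount_le_or_le (mulLeft_string ℓ v (1 : k))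
        ((mulHasFullRank_pow _ t _ _).1 (hfull t i))) ((isAlmostCentered_iff hs).1 hac)
    refine ⟨_, add_mem_tensorGrading_one hℓ d, fun t i => ?_⟩
    refine (mulHasFullRank_pow _ t _ _).2 ((hs.tensor d).injOn_or_surjOn (fun s p q => ?_) hc t i)
    simpa using mulLeft_tensor_string ℓ v d (1 : k) s p q
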